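/- Let $U=\begin{pmatrix} l_1&l_2\\ r_1&r_2\end{pmatrix}$ be a unitary $2\times 2$ complex matrix with $l_1l_2r_1r_2\neq 0$, and put $L=\begin{pmatrix} l_1&l_2\\ 0&0\end{pmatrix}$ and $R=\begin{pmatrix} 0&0\\ r_1&r_2\end{pmatrix}$. Let $a,b\in\mathbb{C}$ with $|a|^2+|b|^2=1$. Define $\psi_n:\mathbb{Z}\to\mathbb{C}^2$ for $n\ge 0$ by $\psi_0(0)=\begin{pmatrix} a\\ b\end{pmatrix}$, $\psi_0(x)=0$ for $x\neq 0$, and $$\psi_{n+1}(x)=L\,\psi_n(x+1)+R\,\psi_n(x-1)\qquad (x\in\mathbb{Z}).$$ Let $X_n$ be a $\mathbb{Z}$-valued random variable with $\mathbb{P}(X_n=x)=\|\psi_n(x)\|^2$ for all $x\in\mathbb{Z}$, where $\|\cdot\|$ is the Euclidean norm on $\mathbb{C}^2$. Then, as $n\to\infty$, $X_n/n$ converges in distribution to a probability measure on $\mathbb{R}$ whose density with respect to Lebesgue measure is the nonnegative function $$\rho(y)=\frac{\sqrt{1-|l_1|^2}}{\pi(1-y^2)\sqrt{|l_1|^2-y^2}}\,(1-\beta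 y)\,1_{(-|l_1|,|l_1|)}(y),$$ where $\beta$ is the real number $$\beta=|a|^2-|b|^2+\frac{\overline{l_1}\,l_2\,\overline{a}\,b+l_1\,\overline{l_2}\,a\,\overline{b}}{|l_1|^2}.$$ -/

import Mathlib

open MeasureTheory Filter Topology
open scoped Matrix ComplexConjugate

namespace QuantumWalk

/-- A wave function on the integer line: `ψ x 0` and `ψ x 1` are the amplitudes of finding the
particle at site `x` with left, respectively right, chirality. -/
abbrev Wave : Type := ℤ → Fin 2 → ℂ

/-- The matrix `L`, keeping the first row `(l₁, l₂)` of the coin `U`. -/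
def leftPart (U : Matrix (Fin 2) (Fin 2) ℂ) : Matrix (Fin 2) (Fin 2) ℂ :=
  !![U 0 0, U 0 1; 0, 0]

/-- The matrix `R`, keeping the second row `(r₁, r₂)` of the coin `U`. -/
def rightPart (U : Matrix (Fin 2) (Fin 2) ℂ) : Matrix (Fin 2) (Fin 2) ℂ :=
  !![0, 0; U 1 0, U 1 1]

/-- One step of the walk: `ψ ↦ (x ↦ L ψ(x + 1) + R ψ(x - 1))`. -/
def step (U : Matrix (Fin 2) (Fin 2) ℂ) (ψ : Wave) : Wave :=
  fun x => leftPart U *ᵥ ψ (x + 1) + rightPart U *ᵥ ψ (x - 1)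

/-- The wave function after `n` steps from the initial state `ψ₀`. -/
def walk (U : Matrix (Fin 2) (Fin 2) ℂ) (ψ₀ : Wave) : ℕ → Wave
  | 0 => ψ₀
  | n + 1 => step U (walk U ψ₀ n)

/-- The squared Euclidean norm `‖ψ(x)‖²` on `ℂ²`. -/
noncomputable def weight (ψ : Wave) (x : ℤ) : ℝ := ‖ψ x 0‖ ^ 2 + ‖ψ x 1‖ ^ 2

/-- `ψ` is a unit vector of `ℓ²(ℤ, ℂ²)`. -/
def IsUnitState (ψ : Wave) : Prop := HasSum (weight ψ) 1

/-- The qubit state `(a, b)` located at the origin. -/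
def originState (a b : ℂ) : Wave := Pi.single 0 ![a, b]

theorem isUnitState_originState {a b : ℂ} (h : ‖a‖ ^ 2 + ‖b‖ ^ 2 = 1) :
    IsUnitState (originState a b) := by
  have h0 : weight (originState a b) 0 = 1 := by simp [weight, originState, h]
  unfold IsUnitState
  rw [← h0]
  refine hasSum_single 0 fun x hx => ?_
  simp [weight, originState, Pi.single_eq_of_ne hx]

theorem coin_isometry {U : Matrix (Fin 2) (Fin 2) ℂ} (hU : U ∈ Matrix.unitaryGroup (Fin 2) ℂ)
    (v : Fin 2 → ℂ) :
    ‖U 0 0 * v 0 + U 0 1 * v 1‖ ^ 2 + ‖U 1 0 * v 0 + U 1 1 * v 1‖ ^ 2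
      = ‖v 0‖ ^ 2 + ‖v 1‖ ^ 2 := by
  have h := Matrix.mem_unitaryGroup_iff'.1 hU
  have h00 := congrFun (congrFun h 0) 0
  have h01 := congrFun (congrFun h 0) 1
  have h10 := congrFun (congrFun h 1) 0
  have h11 := congrFun (congrFun h 1) 1
  simp [Matrix.mul_apply, Fin.sum_univ_two, Matrix.star_apply] at h00 h01 h10 h11
  apply Complex.ofReal_injective
  push_cast
  simp only [← Complex.conj_mul', map_add, map_mul]
  linear_combination conj (v 0) * v 0 * h00 + conj (v 0) * v 1 * h01
    + conj (v 1) * v 0 * h10 + conj (v 1) * v 1 * h11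

theorem isUnitState_step {U : Matrix (Fin 2) (Fin 2) ℂ}
    (hU : U ∈ Matrix.unitaryGroup (Fin 2) ℂ) {ψ : Wave} (hψ : IsUnitState ψ) :
    IsUnitState (step U ψ) := by
  let A : ℤ → ℝ := fun x => ‖U 0 0 * ψ x 0 + U 0 1 * ψ x 1‖ ^ 2
  let B : ℤ → ℝ := fun x => ‖U 1 0 * ψ x 0 + U 1 1 * ψ x 1‖ ^ 2
  have hA0 : ∀ x, 0 ≤ A x := fun x => sq_nonneg _
  have hB0 : ∀ x, 0 ≤ B x := fun x => sq_nonneg _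
  have hAB : ∀ x, A x + B x = weight ψ x := fun x => coin_isometry hU (ψ x)
  have hstep : ∀ x, weight (step U ψ) x = A (x + 1) + B (x - 1) := by
    intro x
    simp [A, B, weight, step, leftPart, rightPart, dotProduct, Fin.sum_univ_two]
  clear_value A B
  have sA : Summable A := Summable.of_nonneg_of_le hA0
    (fun x => by linarith [hAB x, hB0 x]) hψ.summable
  have sB : Summable B := Summable.of_nonneg_of_le hB0
    (fun x => by linarith [hAB x, hA0 x]) hψ.summable
  have e : ∑' x, A x + ∑' x, B x = 1 := by
    rw [← sA.tsum_add sB, ← hψ.tsum_eq]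
    exact tsum_congr hAB
  have hA1 : HasSum (A ∘ Equiv.addRight (1 : ℤ)) (∑' x, A x) :=
    (Equiv.hasSum_iff _).2 sA.hasSum
  have hB1 : HasSum (B ∘ Equiv.subRight (1 : ℤ)) (∑' x, B x) :=
    (Equiv.hasSum_iff _).2 sB.hasSum
  have hs := hA1.add hB1
  rw [e] at hs
  unfold IsUnitState
  rw [funext hstep]
  exact hs

theorem isUnitState_walk {U : Matrix (Fin 2) (Fin 2) ℂ}
    (hU : U ∈ Matrix.unitaryGroup (Fin 2) ℂ) {ψ₀ : Wave} (hψ : IsUnitState ψ₀) (n : ℕ) :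
    IsUnitState (walk U ψ₀ n) := by
  induction n with
  | zero => exact hψ
  | succ n ih => exact isUnitState_step hU ih

/-- The law of the position of a particle in the state `ψ`: the measure on `ℤ` giving the mass
`‖ψ(x)‖²` to each site `x`. -/
noncomputable def positionLaw (ψ : Wave) : Measure ℤ :=
  Measure.sum fun x => ENNReal.ofReal (weight ψ x) • Measure.dirac x

theorem positionLaw_singleton (ψ : Wave) (x : ℤ) :
    positionLaw ψ {x} = ENNReal.ofReal (weight ψ x) := by
  rw [positionLaw, Measure.sum_apply _ (measurableSet_singleton x), tsum_eq_single x]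
  · simp
  · intro y hy
    simp [hy]

theorem isProbabilityMeasure_positionLaw {ψ : Wave} (hψ : IsUnitState ψ) :
    IsProbabilityMeasure (positionLaw ψ) := by
  constructor
  have h0 : ∀ x, 0 ≤ weight ψ x := fun x => by unfold weight; positivity
  rw [positionLaw, Measure.sum_apply _ MeasurableSet.univ]
  simp only [Measure.smul_apply, measure_univ, smul_eq_mul, mul_one]
  rw [← ENNReal.ofReal_tsum_of_nonneg h0 hψ.summable, hψ.tsum_eq, ENNReal.ofReal_one]

theorem isProbabilityMeasure_map_positionLaw {ψ : Wave} (hψ : IsUnitState ψ) (f : ℤ → ℝ) :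
    IsProbabilityMeasure ((positionLaw ψ).map f) :=
  haveI := isProbabilityMeasure_positionLaw hψ
  Measure.isProbabilityMeasure_map (measurable_of_countable f).aemeasurable

/-- The law of `X_n / n`, where `X_n` is the position of the walk at time `n`, that is,
`P (X_n = x) = ‖ψ_n(x)‖²` for all `x` in `ℤ`. -/
noncomputable def scaledLaw {U : Matrix (Fin 2) (Fin 2) ℂ} (hU : U ∈ Matrix.unitaryGroup (Fin 2) ℂ)
    {ψ₀ : Wave} (hψ : IsUnitState ψ₀) (n : ℕ) : ProbabilityMeasure ℝ :=
  ⟨(positionLaw (walk U ψ₀ n)).map fun x : ℤ => (x : ℝ) / (n : ℝ),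
    isProbabilityMeasure_map_positionLaw (isUnitState_walk hU hψ n) _⟩

/-- The real number
`β = |a|² - |b|² + (conj l₁ * l₂ * conj a * b + l₁ * conj l₂ * a * conj b) / |l₁|²`; the numerator
of the fraction is real, see `ofReal_beta`. -/
noncomputable def beta (U : Matrix (Fin 2) (Fin 2) ℂ) (a b : ℂ) : ℝ :=
  ‖a‖ ^ 2 - ‖b‖ ^ 2
    + (conj (U 0 0) * U 0 1 * conj a * b + U 0 0 * conj (U 0 1) * a * conj b).re / ‖U 0 0‖ ^ 2

theorem ofReal_beta (U : Matrix (Fin 2) (Fin 2) ℂ) (a b : ℂ) :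
    (beta U a b : ℂ) = (‖a‖ : ℂ) ^ 2 - (‖b‖ : ℂ) ^ 2
      + (conj (U 0 0) * U 0 1 * conj a * b + U 0 0 * conj (U 0 1) * a * conj b)
        / (‖U 0 0‖ : ℂ) ^ 2 := by
  have h : (((conj (U 0 0) * U 0 1 * conj a * b + U 0 0 * conj (U 0 1) * a * conj b).re : ℝ) : ℂ)
      = conj (U 0 0) * U 0 1 * conj a * b + U 0 0 * conj (U 0 1) * a * conj b := by
    apply Complex.conj_eq_iff_re.1
    simp only [map_add, map_mul, Complex.conj_conj]
    ring
  rw [← h, beta]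
  simp only [Complex.ofReal_add, Complex.ofReal_sub, Complex.ofReal_div, Complex.ofReal_pow]

/-- The density
`√(1 - |l₁|²) / (π (1 - y²) √(|l₁|² - y²)) * (1 - β y)` on `(-|l₁|, |l₁|)`, and `0` elsewhere. -/
noncomputable def limitDensity (U : Matrix (Fin 2) (Fin 2) ℂ) (a b : ℂ) : ℝ → ℝ :=
  (Set.Ioo (-‖U 0 0‖) ‖U 0 0‖).indicator fun y =>
    √(1 - ‖U 0 0‖ ^ 2) / (Real.pi * (1 - y ^ 2) * √(‖U 0 0‖ ^ 2 - y ^ 2))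
      * (1 - beta U a b * y)

end QuantumWalk

namespace QuantumWalk

/-! ### The walk in momentum space -/

/-! This is the Fourier proof of Konno's limit law, by convergence of characteristic functions. In
momentum space a step is multiplication by the unitary matrix `momentumCoin U k`, that is
`diag(e^{-ik}, e^{ik}) U`. With `φ = (a, b)`, Parseval writes the characteristic function of `X_n /
n` at `t` as the mean over `k` of the inner product of `U(k)^n φ` and `U(k + t/n)^n φ`
(`charFun_scaledLaw_originState`).

Put `c = |l₁|`. After a translation of `k`, the coin is `δ exp(i ω(k) N(k))` with `|δ| = 1`, `cos ω
= c cos k` and `N(k)` a Hermitian involution (`exists_momentumCoin_eq_smul_rotation`), so its powers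
are explicit. Each factor oscillates, but `N(k + t/n) → N(k)` and `n (ω(k + t/n) - ω(k)) → t v(k)`
with `v = ω'` the group velocity; the inner product tends to `cos(tv) + i ⟨φ, Nφ⟩ sin(tv)`, and
dominated convergence passes this to the integral (`tendsto_charFun_scaledLaw`).

Now `⟨φ, Nφ⟩ = γ cos k / sin ω - β v`. The reflection `k ↦ π - k` fixes `v` and kills the `γ` term;
oddness of `v` turns the rest into `π⁻¹ ∫ (1 - βv) e^{itv} dk` over `(-π/2, π/2)`
(`integral_charFun_symmetrize`). There `v` increases from `-c` to `c`, and the substitution `y =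
v(k)` produces the stated density (`deriv_velocity_mul_density`). Its sign rests on `|β| c ≤ 1`, a
Cauchy–Schwarz inequality (`abs_drift_mul_le_one`). -/

theorem finite_support_step (U : Matrix (Fin 2) (Fin 2) ℂ) {ψ : Wave}
    (hψ : (Function.support ψ).Finite) : (Function.support (step U ψ)).Finite := by
  have h1 := hψ.preimage (f := fun x : ℤ => x + 1) (add_left_injective 1).injOn
  have h2 := hψ.preimage (f := fun x : ℤ => x - 1) (sub_left_injective (b := (1 : ℤ))).injOn
  refine (h1.union h2).subset fun x hx => ?_
  by_contra hx'
  simp only [Set.mem_union, Set.mem_preimage, Function.mem_support, not_or, not_not] at hx'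
  exact hx (by simp [step, hx'.1, hx'.2])

/-- Keeps every Fourier series a trigonometric polynomial, so sums and integrals may be exchanged
freely. -/
theorem finite_support_walk (U : Matrix (Fin 2) (Fin 2) ℂ) {ψ : Wave}
    (hψ : (Function.support ψ).Finite) (n : ℕ) : (Function.support (walk U ψ n)).Finite := by
  induction n with
  | zero => exact hψ
  | succ n ih => exact finite_support_step U ih

theorem finite_support_originState (a b : ℂ) : (Function.support (originState a b)).Finite :=
  (Set.finite_singleton 0).subset Pi.support_single_subset

/-- The Fourier series of a wave function. -/
noncomputable def fourierWave (ψ : Wave) (k : ℝ) : Fin 2 → ℂ :=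
  fun j => ∑' x : ℤ, Complex.exp (Complex.I * k * x) * ψ x j

theorem hasSum_fourierWave {ψ : Wave} (hψ : (Function.support ψ).Finite) (k : ℝ) (j : Fin 2) :
    HasSum (fun x : ℤ => Complex.exp (Complex.I * k * x) * ψ x j) (fourierWave ψ k j) := by
  refine (summable_of_hasFiniteSupport (hψ.subset fun x hx => ?_)).hasSum
  contrapose! hx
  simp only [Function.mem_support, not_not] at hx
  simp [hx]

/-- The coin in momentum space. -/
noncomputable def momentumCoin (U : Matrix (Fin 2) (Fin 2) ℂ) (k : ℝ) :
    Matrix (Fin 2) (Fin 2) ℂ :=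
  !![Complex.exp (-(Complex.I * k)) * U 0 0, Complex.exp (-(Complex.I * k)) * U 0 1;
    Complex.exp (Complex.I * k) * U 1 0, Complex.exp (Complex.I * k) * U 1 1]

/-- Reading `ψ` at `x + 1` or `x - 1` multiplies its Fourier series by `e^{-ik}` or `e^{ik}`; these
are the factors on the two rows of the coin. -/
theorem fourierWave_step (U : Matrix (Fin 2) (Fin 2) ℂ) {ψ : Wave}
    (hψ : (Function.support ψ).Finite) (k : ℝ) :
    fourierWave (step U ψ) k = momentumCoin U k *ᵥ fourierWave ψ k := by
  have h0 := hasSum_fourierWave hψ k 0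
  have h1 := hasSum_fourierWave hψ k 1
  have hL : HasSum (fun x : ℤ => Complex.exp (Complex.I * k * x) * step U ψ x 0) _ :=
    (((Equiv.addRight (1 : ℤ)).hasSum_iff.2
      ((h0.mul_left (U 0 0)).add (h1.mul_left (U 0 1)))).mul_left
        (Complex.exp (-(Complex.I * k)))).congr_fun fun x => by
      have e : Complex.exp (Complex.I * k * x)
          = Complex.exp (-(Complex.I * k)) * Complex.exp (Complex.I * k * ((x + 1 : ℤ) : ℂ)) := by
        rw [← Complex.exp_add]; congr 1; push_cast; ring
      simp [step, leftPart, rightPart, dotProduct, Fin.sum_univ_two, e]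
      ring
  have hR : HasSum (fun x : ℤ => Complex.exp (Complex.I * k * x) * step U ψ x 1) _ :=
    (((Equiv.subRight (1 : ℤ)).hasSum_iff.2
      ((h0.mul_left (U 1 0)).add (h1.mul_left (U 1 1)))).mul_left
        (Complex.exp (Complex.I * k))).congr_fun fun x => by
      have e : Complex.exp (Complex.I * k * x)
          = Complex.exp (Complex.I * k) * Complex.exp (Complex.I * k * ((x - 1 : ℤ) : ℂ)) := by
        rw [← Complex.exp_add]; congr 1; push_cast; ring
      simp [step, leftPart, rightPart, dotProduct, Fin.sum_univ_two, e]
      ring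
  ext j
  fin_cases j
  · refine ((hasSum_fourierWave (finite_support_step U hψ) k 0).unique hL).trans ?_
    simp [momentumCoin, dotProduct, Fin.sum_univ_two]
    ring
  · refine ((hasSum_fourierWave (finite_support_step U hψ) k 1).unique hR).trans ?_
    simp [momentumCoin, dotProduct, Fin.sum_univ_two]
    ring

theorem fourierWave_walk (U : Matrix (Fin 2) (Fin 2) ℂ) {ψ : Wave}
    (hψ : (Function.support ψ).Finite) (n : ℕ) (k : ℝ) :
    fourierWave (walk U ψ n) k = momentumCoin U k ^ n *ᵥ fourierWave ψ k := by
  induction n with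
  | zero => simp [walk]
  | succ n ih =>
    rw [walk, fourierWave_step U (finite_support_walk U hψ n), ih, pow_succ', Matrix.mulVec_mulVec]

theorem fourierWave_originState (a b : ℂ) (k : ℝ) :
    fourierWave (originState a b) k = ![a, b] := by
  ext j
  rw [fourierWave, tsum_eq_single 0]
  · simp [originState]
  · intro x hx
    simp [originState, Pi.single_eq_of_ne hx]

theorem integral_exp_int_mul (m : ℤ) :
    ∫ k in (-Real.pi)..Real.pi, Complex.exp (Complex.I * m * (k : ℂ))
      = if m = 0 then 2 * (Real.pi : ℂ) else 0 := by
  split_ifs with hm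
  · simp [hm]; ring
  · have hc : Complex.I * (m : ℂ) ≠ 0 := by simp [hm]
    rw [integral_exp_mul_complex hc, div_eq_zero_iff, sub_eq_zero]
    left
    rw [Complex.exp_eq_exp_iff_exists_int]
    exact ⟨m, by push_cast; ring⟩

/-- Parseval's identity for the position distribution. -/
theorem integral_dotProduct_fourierWave {ψ : Wave} (hψ : (Function.support ψ).Finite)
    (θ s : ℝ) :
    ∫ k in (-Real.pi)..Real.pi,
      (star (fourierWave ψ (k + θ)) ⬝ᵥ fourierWave ψ (k + θ + s))
      = 2 * Real.pi * ∑' x : ℤ, (weight ψ x : ℂ) * Complex.exp (Complex.I * s * x) := by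
  set S := hψ.toFinset with hS
  have hz : ∀ x ∉ S, ψ x = 0 := fun x hx => by simpa [hS] using hx
  have hF : ∀ k j, fourierWave ψ k j = ∑ x ∈ S, Complex.exp (Complex.I * k * x) * ψ x j :=
    fun k j => tsum_eq_sum fun x hx => by simp [hz x hx]
  have key : ∀ j, ∫ k in (-Real.pi)..Real.pi,
      (conj (fourierWave ψ (k + θ) j) * fourierWave ψ (k + θ + s) j)
      = 2 * Real.pi * ∑ x ∈ S, ((‖ψ x j‖ ^ 2 : ℝ) : ℂ) * Complex.exp (Complex.I * s * x) := by
    intro j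
    have e : ∀ k : ℝ, conj (fourierWave ψ (k + θ) j) * fourierWave ψ (k + θ + s) j
        = ∑ x ∈ S, ∑ y ∈ S, (conj (ψ x j) * ψ y j * Complex.exp (Complex.I * s * y)
          * Complex.exp (Complex.I * θ * ((y - x : ℤ) : ℂ)))
          * Complex.exp (Complex.I * ((y - x : ℤ) : ℂ) * (k : ℂ)) := by
      intro k
      rw [hF, hF, map_sum, Finset.sum_mul_sum]
      refine Finset.sum_congr rfl fun x _ => Finset.sum_congr rfl fun y _ => ?_
      have e1 : conj (Complex.exp (Complex.I * ((k + θ : ℝ) : ℂ) * x))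
          = Complex.exp (-(Complex.I * ((k + θ : ℝ) : ℂ) * x)) := by
        rw [← Complex.exp_conj]; simp
      have e2 : Complex.exp (-(Complex.I * ((k + θ : ℝ) : ℂ) * x))
          * Complex.exp (Complex.I * ((k + θ + s : ℝ) : ℂ) * y)
          = Complex.exp (Complex.I * s * y) * Complex.exp (Complex.I * θ * ((y - x : ℤ) : ℂ))
            * Complex.exp (Complex.I * ((y - x : ℤ) : ℂ) * (k : ℂ)) := by
        rw [← Complex.exp_add, ← Complex.exp_add, ← Complex.exp_add]
        congr 1; push_cast; ring
      rw [map_mul, e1]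
      linear_combination (conj (ψ x j) * ψ y j) * e2
    simp_rw [e]
    rw [intervalIntegral.integral_finsetSum fun x _ =>
      (Continuous.intervalIntegrable (by fun_prop) _ _), Finset.mul_sum]
    refine Finset.sum_congr rfl fun x hx => ?_
    rw [intervalIntegral.integral_finsetSum fun x _ =>
      (Continuous.intervalIntegrable (by fun_prop) _ _)]
    simp_rw [intervalIntegral.integral_const_mul, integral_exp_int_mul]
    -- Orthogonality leaves only the diagonal `y = x`, where the phase coming from `θ` is `1`; hence
    -- the right-hand side does not depend on `θ`.
    rw [Finset.sum_eq_single x]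
    · simp [← Complex.conj_mul']; ring
    · intro y _ hy
      simp [sub_eq_zero, hy]
    · exact fun h => absurd hx h
  have hc : ∀ j t, Continuous fun k : ℝ => fourierWave ψ (k + t) j := by
    intro j t
    simp_rw [hF]
    fun_prop
  have hc' : ∀ j, Continuous fun k : ℝ =>
      conj (fourierWave ψ (k + θ) j) * fourierWave ψ (k + θ + s) j := by
    intro j
    simp_rw [add_assoc _ θ s]
    exact (Complex.continuous_conj.comp (hc j θ)).mul (hc j (θ + s))
  simp only [dotProduct, Fin.sum_univ_two, Pi.star_apply, RCLike.star_def]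
  rw [intervalIntegral.integral_add ((hc' 0).intervalIntegrable _ _)
    ((hc' 1).intervalIntegrable _ _), key, key, ← mul_add, ← Finset.sum_add_distrib,
    tsum_eq_sum (s := S) fun x hx => by simp [weight, hz x hx]]
  congr 1
  refine Finset.sum_congr rfl fun x _ => ?_
  rw [weight]
  push_cast
  ring

/-- The factor `1 / n` moves from the position to the frequency. The case `n = 0` is covered, since
division by zero gives zero on both sides. -/
theorem charFun_scaledLaw {U : Matrix (Fin 2) (Fin 2) ℂ}
    (hU : U ∈ Matrix.unitaryGroup (Fin 2) ℂ) {ψ : Wave} (hψ : IsUnitState ψ) (n : ℕ) (t : ℝ) :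
    charFun (scaledLaw hU hψ n : Measure ℝ) t
      = ∑' x : ℤ, (weight (walk U ψ n) x : ℂ) * Complex.exp (Complex.I * (t / n : ℝ) * x) := by
  have hw := isUnitState_walk hU hψ n
  have := isProbabilityMeasure_positionLaw hw
  change charFun ((positionLaw (walk U ψ n)).map fun x : ℤ => (x : ℝ) / (n : ℝ)) t = _
  rw [charFun_apply_real, integral_map (measurable_of_countable _).aemeasurable
    (by fun_prop), integral_countable]
  · refine tsum_congr fun x => ?_
    rw [measureReal_def, positionLaw_singleton, ENNReal.toReal_ofReal (by unfold weight; positivity),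
      Complex.real_smul]
    congr 2
    push_cast
    ring
  · refine Integrable.of_bound (C := 1) (measurable_of_countable _).aestronglyMeasurable
      (ae_of_all _ fun x => ?_)
    rw [← Complex.ofReal_mul, Complex.norm_exp_ofReal_mul_I]

theorem charFun_scaledLaw_originState {U : Matrix (Fin 2) (Fin 2) ℂ}
    (hU : U ∈ Matrix.unitaryGroup (Fin 2) ℂ) {a b : ℂ} (hab : ‖a‖ ^ 2 + ‖b‖ ^ 2 = 1)
    (n : ℕ) (t θ : ℝ) :
    charFun (scaledLaw hU (isUnitState_originState hab) n : Measure ℝ) t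
      = (2 * Real.pi : ℂ)⁻¹ * ∫ k in (-Real.pi)..Real.pi,
        (star (momentumCoin U (k + θ) ^ n *ᵥ ![a, b])
          ⬝ᵥ (momentumCoin U (k + θ + t / n) ^ n *ᵥ ![a, b])) := by
  have h := integral_dotProduct_fourierWave
    (finite_support_walk U (finite_support_originState a b) n) θ (t / n)
  simp_rw [fourierWave_walk U (finite_support_originState a b), fourierWave_originState] at h
  have hpi : (2 * Real.pi : ℂ) ≠ 0 := by simp [Real.pi_ne_zero]
  rw [h, inv_mul_cancel_left₀ hpi, charFun_scaledLaw]

/-! ### Powers of the coin and their asymptotics -/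

/-- For an involution `N`, this is `exp (i ω N)`. -/
noncomputable def rotation (N : Matrix (Fin 2) (Fin 2) ℂ) (ω : ℝ) : Matrix (Fin 2) (Fin 2) ℂ :=
  (Real.cos ω : ℂ) • 1 + (Complex.I * (Real.sin ω : ℂ)) • N

theorem rotation_pow {N : Matrix (Fin 2) (Fin 2) ℂ} (hN : N * N = 1) (ω : ℝ) (n : ℕ) :
    rotation N ω ^ n = rotation N (n * ω) := by
  induction n with
  | zero => simp [rotation]
  | succ n ih =>
    rw [pow_succ, ih, rotation, rotation, rotation]
    have e : ((n + 1 : ℕ) : ℝ) * ω = n * ω + ω := by push_cast; ring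
    rw [e, Real.cos_add, Real.sin_add]
    simp only [add_mul, mul_add, smul_mul_smul_comm, hN, mul_one, one_mul]
    push_cast
    have hI := Complex.I_mul_I
    match_scalars
    · linear_combination (Complex.sin (n * ω) * Complex.sin ω) * hI
    · ring

theorem star_rotation_mulVec_dotProduct {N N' : Matrix (Fin 2) (Fin 2) ℂ} (hN : Nᴴ = N)
    (ω ω' : ℝ) (φ : Fin 2 → ℂ) :
    star (rotation N ω *ᵥ φ) ⬝ᵥ (rotation N' ω' *ᵥ φ)
      = (Real.cos ω * Real.cos ω' : ℝ) * (star φ ⬝ᵥ φ)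
        + (Real.sin ω * Real.sin ω' : ℝ) * (star φ ⬝ᵥ ((N * N') *ᵥ φ))
        + Complex.I * ((Real.cos ω * Real.sin ω' : ℝ) * (star φ ⬝ᵥ (N' *ᵥ φ))
          - (Real.sin ω * Real.cos ω' : ℝ) * (star φ ⬝ᵥ (N *ᵥ φ))) := by
  have hs : ∀ x, star (N *ᵥ φ) ⬝ᵥ x = star φ ⬝ᵥ (N *ᵥ x) := fun x => by
    rw [Matrix.star_mulVec, hN, Matrix.dotProduct_mulVec]
  have hI := Complex.I_mul_I
  simp only [rotation, Matrix.add_mulVec, Matrix.smul_mulVec, Matrix.one_mulVec, star_add,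
    star_smul, add_dotProduct, dotProduct_add, smul_dotProduct, dotProduct_smul, hs,
    Matrix.mulVec_mulVec, smul_eq_mul, star_mul', RCLike.star_def, Complex.conj_I,
    Complex.conj_ofReal]
  push_cast
  linear_combination (-Complex.sin ω * Complex.sin ω' * (star φ ⬝ᵥ ((N * N') *ᵥ φ))) * hI

/-- In the expanded product, replace `⟨φ, N N' φ⟩` by `1` and `⟨φ, N' φ⟩` by `⟨φ, N φ⟩`. The errors
tend to zero and carry bounded trigonometric factors; the addition formulas collapse the rest to a
function of the phase difference alone. -/
theorem tendsto_star_rotation_dotProduct {N : ℝ → Matrix (Fin 2) (Fin 2) ℂ} {ω : ℝ → ℝ}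
    {k v : ℝ} (hNc : ContinuousAt N k) (hN : (N k)ᴴ = N k) (hN2 : N k * N k = 1)
    (hω : HasDerivAt ω v k) {φ : Fin 2 → ℂ} (hφ : star φ ⬝ᵥ φ = 1) (t : ℝ) :
    Tendsto (fun n : ℕ => star (rotation (N k) (n * ω k) *ᵥ φ)
        ⬝ᵥ (rotation (N (k + t / n)) (n * ω (k + t / n)) *ᵥ φ)) atTop
      (𝓝 (Real.cos (t * v) + Complex.I * (star φ ⬝ᵥ (N k *ᵥ φ)) * Real.sin (t * v))) := by
  have hk : Tendsto (fun n : ℕ => k + t / n) atTop (𝓝 k) := by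
    simpa using (tendsto_const_div_atTop_nhds_zero_nat t).const_add k
  have hNn : Tendsto (fun n : ℕ => N (k + t / n)) atTop (𝓝 (N k)) := hNc.tendsto.comp hk
  have hp : Tendsto (fun n : ℕ => star φ ⬝ᵥ ((N k * N (k + t / n)) *ᵥ φ) - 1) atTop (𝓝 0) := by
    have hc : Continuous fun M : Matrix (Fin 2) (Fin 2) ℂ => star φ ⬝ᵥ ((N k * M) *ᵥ φ) - 1 := by
      fun_prop
    have := (hc.tendsto (N k)).comp hNn
    rwa [hN2, Matrix.one_mulVec, hφ, sub_self] at this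
  have hq : Tendsto (fun n : ℕ => star φ ⬝ᵥ (N (k + t / n) *ᵥ φ) - star φ ⬝ᵥ (N k *ᵥ φ))
      atTop (𝓝 0) := by
    have hc : Continuous fun M : Matrix (Fin 2) (Fin 2) ℂ =>
        star φ ⬝ᵥ (M *ᵥ φ) - star φ ⬝ᵥ (N k *ᵥ φ) := by
      fun_prop
    have := (hc.tendsto (N k)).comp hNn
    rwa [sub_self] at this
  have hphase : Tendsto (fun n : ℕ => n * ω (k + t / n) - n * ω k) atTop (𝓝 (t * v)) := by
    -- Differentiating in `u = 1/n` rather than in the increment `t/n` includes `t = 0`.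
    have hg : HasDerivAt (fun u : ℝ => ω (k + t * u)) (t * v) 0 := by
      have h1 : HasDerivAt (fun u : ℝ => k + t * u) t 0 := by
        simpa using ((hasDerivAt_id (0 : ℝ)).const_mul t).const_add k
      have h2 : HasDerivAt ω v (k + t * 0) := by simpa using hω
      have h3 := h2.comp (0 : ℝ) h1
      rwa [mul_comm v t] at h3
    have h0 : Tendsto (fun n : ℕ => (n : ℝ)⁻¹) atTop (𝓝[≠] 0) :=
      tendsto_nhdsWithin_iff.2 ⟨tendsto_inv_atTop_nhds_zero_nat,
        (eventually_gt_atTop 0).mono fun n hn => by simp [hn.ne']⟩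
    refine (hg.tendsto_slope_zero.comp h0).congr fun n => ?_
    simp only [Function.comp_apply, inv_inv, smul_eq_mul, zero_add, mul_zero, add_zero,
      div_eq_mul_inv]
    ring
  have bdd : ∀ {r : ℕ → ℝ} {z : ℕ → ℂ}, (∀ n, |r n| ≤ 1) → Tendsto z atTop (𝓝 0) →
      Tendsto (fun n => (r n : ℂ) * z n) atTop (𝓝 0) := by
    intro r z hr hz
    refine squeeze_zero_norm (fun n => ?_) (tendsto_zero_iff_norm_tendsto_zero.1 hz)
    rw [norm_mul, Complex.norm_real, Real.norm_eq_abs]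
    exact mul_le_of_le_one_left (norm_nonneg _) (hr n)
  have habs : ∀ {x y : ℝ}, |x| ≤ 1 → |y| ≤ 1 → |x * y| ≤ 1 := fun hx hy => by
    rw [abs_mul]; exact mul_le_one₀ hx (abs_nonneg _) hy
  have t1 := bdd (r := fun n : ℕ => Real.sin (n * ω k) * Real.sin (n * ω (k + t / n)))
    (fun n => habs (Real.abs_sin_le_one _) (Real.abs_sin_le_one _)) hp
  have t2 := (bdd (r := fun n : ℕ => Real.cos (n * ω k) * Real.sin (n * ω (k + t / n)))
    (fun n => habs (Real.abs_cos_le_one _) (Real.abs_sin_le_one _)) hq).const_mul Complex.I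
  have t3 : Tendsto (fun n : ℕ => ((Real.cos (n * ω (k + t / n) - n * ω k) : ℝ) : ℂ)) atTop
      (𝓝 (Real.cos (t * v) : ℝ)) :=
    (Complex.continuous_ofReal.tendsto _).comp ((Real.continuous_cos.tendsto _).comp hphase)
  have t4 : Tendsto (fun n : ℕ => ((Real.sin (n * ω (k + t / n) - n * ω k) : ℝ) : ℂ)) atTop
      (𝓝 (Real.sin (t * v) : ℝ)) :=
    (Complex.continuous_ofReal.tendsto _).comp ((Real.continuous_sin.tendsto _).comp hphase)
  have := (t3.add (t4.const_mul (Complex.I * (star φ ⬝ᵥ (N k *ᵥ φ))))).add (t1.add t2)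
  simp only [mul_zero, add_zero] at this
  refine this.congr fun n => ?_
  rw [star_rotation_mulVec_dotProduct hN, hφ, Real.cos_sub, Real.sin_sub]
  push_cast
  ring

/-! ### Unitarity, uniform bounds and continuity in momentum space. -/

theorem momentumCoin_mem_unitaryGroup {U : Matrix (Fin 2) (Fin 2) ℂ}
    (hU : U ∈ Matrix.unitaryGroup (Fin 2) ℂ) (k : ℝ) :
    momentumCoin U k ∈ Matrix.unitaryGroup (Fin 2) ℂ := by
  have e : momentumCoin U k = !![Complex.exp (-(Complex.I * k)), 0; 0, Complex.exp (Complex.I * k)]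
      * U := by
    ext i j
    fin_cases i <;> fin_cases j <;> simp [momentumCoin, Matrix.mul_apply, Fin.sum_univ_two]
  rw [e]
  refine mul_mem ?_ hU
  rw [Matrix.mem_unitaryGroup_iff]
  ext i j
  fin_cases i <;> fin_cases j <;>
    simp [Matrix.mul_apply, Fin.sum_univ_two, Matrix.star_apply, ← Complex.exp_conj,
      ← Complex.exp_add]

/-- Entries of a unitary matrix have norm at most `1`. The bound is crude, but it depends on neither
`n` nor `k`, which is what domination needs. -/
theorem norm_star_mulVec_dotProduct_le {A B : Matrix (Fin 2) (Fin 2) ℂ}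
    (hA : A ∈ Matrix.unitaryGroup (Fin 2) ℂ) (hB : B ∈ Matrix.unitaryGroup (Fin 2) ℂ)
    (φ : Fin 2 → ℂ) :
    ‖star (A *ᵥ φ) ⬝ᵥ (B *ᵥ φ)‖ ≤ 2 * (‖φ 0‖ + ‖φ 1‖) ^ 2 := by
  have h : ∀ {M : Matrix (Fin 2) (Fin 2) ℂ}, M ∈ Matrix.unitaryGroup (Fin 2) ℂ → ∀ i,
      ‖(M *ᵥ φ) i‖ ≤ ‖φ 0‖ + ‖φ 1‖ := by
    intro M hM i
    simp only [Matrix.mulVec, dotProduct, Fin.sum_univ_two]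
    refine (norm_add_le _ _).trans (add_le_add ?_ ?_) <;>
    · rw [norm_mul]
      exact mul_le_of_le_one_left (norm_nonneg _) (entry_norm_bound_of_unitary hM _ _)
  have h0 : 0 ≤ ‖φ 0‖ + ‖φ 1‖ := by positivity
  simp only [dotProduct, Fin.sum_univ_two, Pi.star_apply]
  refine (norm_add_le _ _).trans ?_
  rw [norm_mul, norm_mul, norm_star, norm_star]
  have := mul_le_mul (h hA 0) (h hB 0) (norm_nonneg _) h0
  have := mul_le_mul (h hA 1) (h hB 1) (norm_nonneg _) h0
  linarith

theorem continuous_momentumCoin (U : Matrix (Fin 2) (Fin 2) ℂ) :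
    Continuous (momentumCoin U) := by
  refine continuous_matrix fun i j => ?_
  fin_cases i <;> fin_cases j <;> simp [momentumCoin] <;> fun_prop

/-- The sine of the quasi-energy. -/
noncomputable def energySin (c k : ℝ) : ℝ := √(1 - c ^ 2 * Real.cos k ^ 2)

/-- The group velocity of the walk at momentum `k`. -/
noncomputable def velocity (c k : ℝ) : ℝ := c * Real.sin k / energySin c k

/-- The Hermitian involution generating the coin at momentum `k`. -/
noncomputable def spinAxis (c : ℝ) (m : ℂ) (k : ℝ) : Matrix (Fin 2) (Fin 2) ℂ :=
  (energySin c k : ℂ)⁻¹ •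
    !![-(c * Real.sin k : ℂ), -(Complex.I * m * Complex.exp (-(Complex.I * k)));
      Complex.I * conj m * Complex.exp (Complex.I * k), (c * Real.sin k : ℂ)]

theorem one_sub_sq_mul_cos_sq_pos {c : ℝ} (hc0 : 0 < c) (hc1 : c < 1) (k : ℝ) :
    0 < 1 - c ^ 2 * Real.cos k ^ 2 := by
  have h1 : Real.cos k ^ 2 ≤ 1 := Real.cos_sq_le_one k
  have h2 : c ^ 2 < 1 := by nlinarith
  nlinarith [sq_nonneg c]

theorem energySin_pos {c : ℝ} (hc0 : 0 < c) (hc1 : c < 1) (k : ℝ) : 0 < energySin c k :=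
  Real.sqrt_pos.2 (one_sub_sq_mul_cos_sq_pos hc0 hc1 k)

theorem energySin_sq {c : ℝ} (hc0 : 0 < c) (hc1 : c < 1) (k : ℝ) :
    energySin c k ^ 2 = 1 - c ^ 2 * Real.cos k ^ 2 :=
  Real.sq_sqrt (one_sub_sq_mul_cos_sq_pos hc0 hc1 k).le

theorem continuous_energySin (c : ℝ) : Continuous (energySin c) := by
  unfold energySin
  fun_prop

theorem continuous_velocity {c : ℝ} (hc0 : 0 < c) (hc1 : c < 1) : Continuous (velocity c) :=
  (by fun_prop : Continuous fun k => c * Real.sin k).div (continuous_energySin c)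
    fun k => (energySin_pos hc0 hc1 k).ne'

theorem continuous_spinAxis {c : ℝ} (hc0 : 0 < c) (hc1 : c < 1) (m : ℂ) :
    Continuous (spinAxis c m) := by
  refine Continuous.smul (Continuous.inv₀ (Complex.continuous_ofReal.comp (continuous_energySin c))
    fun k => Complex.ofReal_ne_zero.2 (energySin_pos hc0 hc1 k).ne') ?_
  refine continuous_matrix fun i j => ?_
  fin_cases i <;> fin_cases j <;> simp <;> fun_prop

theorem conjTranspose_spinAxis (c : ℝ) (m : ℂ) (k : ℝ) :
    (spinAxis c m k)ᴴ = spinAxis c m k := by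
  ext i j
  fin_cases i <;> fin_cases j <;>
    simp [spinAxis, ← Complex.exp_conj, ← Complex.sin_conj]

theorem spinAxis_mul_self {c : ℝ} (hc0 : 0 < c) (hc1 : c < 1) {m : ℂ} (hm : ‖m‖ ^ 2 = 1 - c ^ 2)
    (k : ℝ) : spinAxis c m k * spinAxis c m k = 1 := by
  have hs : (energySin c k : ℂ) ≠ 0 := Complex.ofReal_ne_zero.2 (energySin_pos hc0 hc1 k).ne'
  have hs2 : (energySin c k : ℂ) ^ 2 = 1 - c ^ 2 * Complex.cos k ^ 2 := by
    exact_mod_cast congrArg Complex.ofReal (energySin_sq hc0 hc1 k)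
  have hm2 : m * conj m = 1 - c ^ 2 := by
    rw [Complex.mul_conj']; exact_mod_cast congrArg Complex.ofReal hm
  have hE : Complex.exp (-(Complex.I * k)) * Complex.exp (Complex.I * k) = 1 := by
    rw [← Complex.exp_add]; simp
  have hI := Complex.I_mul_I
  have hcs := Complex.sin_sq_add_cos_sq k
  have key : (c * Complex.sin k : ℂ) ^ 2 + m * conj m = (energySin c k : ℂ) ^ 2 := by
    rw [hs2, hm2]; linear_combination (c : ℂ) ^ 2 * hcs
  rw [spinAxis, smul_mul_smul_comm]
  ext i j
  fin_cases i <;> fin_cases j <;> simp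
  · field_simp
    linear_combination key - m * conj m * Complex.I * Complex.I * hE - m * conj m * hI
  · right; ring
  · right; ring
  · field_simp
    linear_combination key - m * conj m * Complex.I * Complex.I * hE - m * conj m * hI

/-- Since `c < 1`, the argument of `arccos` stays strictly inside `(-1, 1)`, so the quasi-energy is
differentiable at every momentum. -/
theorem hasDerivAt_arccos_mul_cos {c : ℝ} (hc0 : 0 < c) (hc1 : c < 1) (k : ℝ) :
    HasDerivAt (fun k => Real.arccos (c * Real.cos k)) (velocity c k) k := by
  have hlt : |c * Real.cos k| < 1 := by
    rw [← sq_lt_one_iff_abs_lt_one]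
    have := one_sub_sq_mul_cos_sq_pos hc0 hc1 k
    rw [mul_pow]; linarith
  rw [abs_lt] at hlt
  have h := (Real.hasDerivAt_arccos hlt.1.ne' hlt.2.ne).comp k
    ((Real.hasDerivAt_cos k).const_mul c)
  refine h.congr_deriv ?_
  rw [velocity, energySin, mul_pow]
  ring

theorem sin_arccos_mul_cos (c k : ℝ) : Real.sin (Real.arccos (c * Real.cos k)) = energySin c k := by
  rw [Real.sin_arccos, energySin, mul_pow]

/-! ### Polar form of the coin and its generator. -/

theorem norm_sq_add_norm_sq_of_mem_unitaryGroup {U : Matrix (Fin 2) (Fin 2) ℂ}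
    (hU : U ∈ Matrix.unitaryGroup (Fin 2) ℂ) : ‖U 0 0‖ ^ 2 + ‖U 0 1‖ ^ 2 = 1 := by
  have h := congrFun (congrFun (Matrix.mem_unitaryGroup_iff.1 hU) 0) 0
  simp [Matrix.mul_apply, Fin.sum_univ_two, Matrix.star_apply, Complex.mul_conj'] at h
  exact_mod_cast h

/-- The polar form of a unitary coin. -/
theorem exists_phases_of_mem_unitaryGroup {U : Matrix (Fin 2) (Fin 2) ℂ}
    (hU : U ∈ Matrix.unitaryGroup (Fin 2) ℂ) (h0 : U 0 0 ≠ 0) :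
    ∃ (δ : ℂ) (θ : ℝ), ‖δ‖ = 1 ∧ U 0 0 = δ * ‖U 0 0‖ * Complex.exp (Complex.I * θ) ∧
      U 0 1 = δ * (conj (U 0 0) * U 0 1 / ‖U 0 0‖) * Complex.exp (Complex.I * θ) ∧
      U 1 0 = -(δ * conj (conj (U 0 0) * U 0 1 / ‖U 0 0‖) * Complex.exp (-(Complex.I * θ))) ∧
      U 1 1 = δ * ‖U 0 0‖ * Complex.exp (-(Complex.I * θ)) := by
  have h := Matrix.mem_unitaryGroup_iff.1 hU
  have h00 := congrFun (congrFun h 0) 0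
  have h10 := congrFun (congrFun h 1) 0
  simp [Matrix.mul_apply, Fin.sum_univ_two, Matrix.star_apply] at h00 h10
  have hc : (‖U 0 0‖ : ℂ) ≠ 0 := by simpa using h0
  set Δ : ℂ := U.det with hΔ
  have hdet : Δ = U 0 0 * U 1 1 - U 0 1 * U 1 0 := Matrix.det_fin_two U
  have h11' : U 1 1 = Δ * conj (U 0 0) := by
    rw [hdet]; linear_combination U 0 1 * h10 - U 1 1 * h00
  have h10' : U 1 0 = -(Δ * conj (U 0 1)) := by
    rw [hdet]; linear_combination U 0 0 * h10 - U 1 0 * h00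
  have hΔ1 : ‖Δ‖ = 1 := CStarRing.norm_of_mem_unitary (Matrix.det_of_mem_unitary hU)
  -- Dividing by a square root of the determinant puts the coin in `SU(2)`; `θ` is then the argument
  -- of its upper left entry.
  obtain ⟨δ, hδ⟩ : ∃ δ : ℂ, δ ^ 2 = Δ := IsAlgClosed.exists_pow_nat_eq Δ two_pos
  have hδ1 : ‖δ‖ = 1 := by
    rw [← hδ, norm_pow] at hΔ1
    exact (pow_eq_one_iff_of_nonneg (norm_nonneg _) two_ne_zero).1 hΔ1
  have hδ0 : δ ≠ 0 := by rintro rfl; simp at hδ1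
  have hδc : δ * conj δ = 1 := by rw [Complex.mul_conj', hδ1]; simp
  set θ := Complex.arg (U 0 0 / δ)
  have e0 : U 0 0 = δ * ‖U 0 0‖ * Complex.exp (Complex.I * θ) := by
    have := Complex.norm_mul_exp_arg_mul_I (U 0 0 / δ)
    rw [norm_div, hδ1, div_one, eq_div_iff hδ0, mul_comm _ Complex.I] at this
    linear_combination -this
  have e0' : conj (U 0 0) = conj δ * ‖U 0 0‖ * Complex.exp (-(Complex.I * θ)) := by
    conv_lhs => rw [e0]
    simp [← Complex.exp_conj]
  have hn : conj (U 0 0) * U 0 0 = ‖U 0 0‖ ^ 2 := Complex.conj_mul' _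
  have x1 : δ * Complex.exp (Complex.I * θ) = U 0 0 / ‖U 0 0‖ := by
    rw [eq_div_iff hc]; linear_combination -e0
  have x2 : conj δ * Complex.exp (-(Complex.I * θ)) = conj (U 0 0) / ‖U 0 0‖ := by
    rw [eq_div_iff hc]; linear_combination -e0'
  refine ⟨δ, θ, hδ1, e0, ?_, ?_, ?_⟩
  · have : δ * (conj (U 0 0) * U 0 1 / ‖U 0 0‖) * Complex.exp (Complex.I * θ)
        = (δ * Complex.exp (Complex.I * θ)) * (conj (U 0 0) * U 0 1 / ‖U 0 0‖) := by ring
    rw [this, x1]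
    field_simp
    linear_combination -(U 0 1) * hn
  · have : -(δ * conj (conj (U 0 0) * U 0 1 / ‖U 0 0‖) * Complex.exp (-(Complex.I * θ)))
        = -(Δ * (conj δ * Complex.exp (-(Complex.I * θ)))
          * (U 0 0 * conj (U 0 1) / ‖U 0 0‖)) := by
      simp only [map_div₀, map_mul, Complex.conj_conj, Complex.conj_ofReal]
      rw [← hδ]
      linear_combination (δ * Complex.exp (-(Complex.I * θ))
          * (U 0 0 * conj (U 0 1) / ‖U 0 0‖)) * hδc
    rw [this, x2, h10']
    field_simp
    linear_combination (Δ * conj (U 0 1)) * hn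
  · rw [h11', e0', ← hδ]
    linear_combination (δ * ‖U 0 0‖ * Complex.exp (-(Complex.I * θ))) * hδc

/-- Shifting the momentum by `θ` absorbs the phase of the diagonal, leaving half-trace `c cos k`
after division by `δ`; this is the cosine of the quasi-energy. -/
theorem exists_momentumCoin_eq_smul_rotation {U : Matrix (Fin 2) (Fin 2) ℂ}
    (hU : U ∈ Matrix.unitaryGroup (Fin 2) ℂ) (h0 : U 0 0 ≠ 0) (h1 : ‖U 0 0‖ < 1) :
    ∃ (δ : ℂ) (θ : ℝ), ‖δ‖ = 1 ∧ ∀ k : ℝ, momentumCoin U (k + θ) =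
      δ • rotation (spinAxis ‖U 0 0‖ (conj (U 0 0) * U 0 1 / ‖U 0 0‖) k)
        (Real.arccos (‖U 0 0‖ * Real.cos k)) := by
  obtain ⟨δ, θ, hδ, e00, e01, e10, e11⟩ := exists_phases_of_mem_unitaryGroup hU h0
  refine ⟨δ, θ, hδ, fun k => ?_⟩
  set c := ‖U 0 0‖
  set m := conj (U 0 0) * U 0 1 / (c : ℂ)
  have hc0 : 0 < c := norm_pos_iff.2 h0
  have hlt : |c * Real.cos k| < 1 := by
    rw [← sq_lt_one_iff_abs_lt_one]
    have := one_sub_sq_mul_cos_sq_pos hc0 h1 k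
    rw [mul_pow]; linarith
  rw [abs_lt] at hlt
  have hs : (energySin c k : ℂ) ≠ 0 := Complex.ofReal_ne_zero.2 (energySin_pos hc0 h1 k).ne'
  have hI := Complex.I_mul_I
  have hE : Complex.exp (Complex.I * θ) * Complex.exp (-(Complex.I * θ)) = 1 := by
    rw [← Complex.exp_add]; simp
  have a1 : Complex.exp (Complex.I * ((k : ℂ) + θ))
      = Complex.exp (Complex.I * k) * Complex.exp (Complex.I * θ) := by
    rw [← Complex.exp_add]; ring_nf
  have a2 : Complex.exp (-(Complex.I * ((k : ℂ) + θ)))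
      = Complex.exp (-(Complex.I * k)) * Complex.exp (-(Complex.I * θ)) := by
    rw [← Complex.exp_add]; ring_nf
  have b1 : Complex.exp (Complex.I * k) = Complex.cos k + Complex.sin k * Complex.I := by
    rw [mul_comm, Complex.exp_mul_I]
  have b2 : Complex.exp (-(Complex.I * k)) = Complex.cos k - Complex.sin k * Complex.I := by
    rw [show -(Complex.I * (k : ℂ)) = -k * Complex.I by ring, Complex.exp_mul_I,
      Complex.cos_neg, Complex.sin_neg]
    ring
  rw [rotation, Real.cos_arccos hlt.1.le hlt.2.le, sin_arccos_mul_cos, spinAxis, smul_smul,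
    mul_assoc, mul_inv_cancel₀ hs, mul_one]
  ext i j
  fin_cases i <;> fin_cases j <;> simp [momentumCoin, a1, a2]
  · rw [e00]
    linear_combination (δ * c * Complex.exp (-(Complex.I * k))) * hE + δ * c * b2
  · rw [e01]
    linear_combination (δ * m * Complex.exp (-(Complex.I * k))) * hE
      + δ * m * Complex.exp (-(Complex.I * k)) * hI
  · rw [e10]
    linear_combination (-δ * conj m * Complex.exp (Complex.I * k)) * hE
      - δ * conj m * Complex.exp (Complex.I * k) * hI
  · rw [e11]
    linear_combination (δ * c * Complex.exp (Complex.I * k)) * hE + δ * c * b1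

theorem tendsto_charFun_scaledLaw {U : Matrix (Fin 2) (Fin 2) ℂ}
    (hU : U ∈ Matrix.unitaryGroup (Fin 2) ℂ) (h0 : U 0 0 ≠ 0) (h1 : ‖U 0 0‖ < 1) {a b : ℂ}
    (hab : ‖a‖ ^ 2 + ‖b‖ ^ 2 = 1) (t : ℝ) :
    Tendsto (fun n => charFun (scaledLaw hU (isUnitState_originState hab) n : Measure ℝ) t) atTop
      (𝓝 ((2 * Real.pi : ℂ)⁻¹ * ∫ k in (-Real.pi)..Real.pi,
        (Real.cos (t * velocity ‖U 0 0‖ k) + Complex.I * (star ![a, b] ⬝ᵥ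
          (spinAxis ‖U 0 0‖ (conj (U 0 0) * U 0 1 / ‖U 0 0‖) k *ᵥ ![a, b]))
            * Real.sin (t * velocity ‖U 0 0‖ k)))) := by
  obtain ⟨δ, θ, hδ, hcoin⟩ := exists_momentumCoin_eq_smul_rotation hU h0 h1
  simp_rw [fun n => charFun_scaledLaw_originState hU hab n t θ]
  refine Tendsto.const_mul _ ?_
  have hc0 : 0 < ‖U 0 0‖ := norm_pos_iff.2 h0
  have hm : ‖conj (U 0 0) * U 0 1 / ‖U 0 0‖‖ ^ 2 = 1 - ‖U 0 0‖ ^ 2 := by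
    have h2 := norm_sq_add_norm_sq_of_mem_unitaryGroup hU
    rw [norm_div, norm_mul, Complex.norm_conj, Complex.norm_real, norm_norm,
      mul_div_cancel_left₀ _ hc0.ne']
    linarith
  have hφ : star ![a, b] ⬝ᵥ ![a, b] = 1 := by
    simp [dotProduct, Fin.sum_univ_two, Complex.conj_mul']
    exact_mod_cast hab
  have hδc : conj δ * δ = 1 := by rw [Complex.conj_mul', hδ]; simp
  refine intervalIntegral.tendsto_integral_filter_of_dominated_convergence
    (fun _ => 2 * (‖(![a, b] : Fin 2 → ℂ) 0‖ + ‖(![a, b] : Fin 2 → ℂ) 1‖) ^ 2)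
    (Eventually.of_forall fun n => ?_)
    (Eventually.of_forall fun n => ae_of_all _ fun k _ => ?_)
    (intervalIntegrable_const) (ae_of_all _ fun k _ => ?_)
  · have hA := continuous_momentumCoin U
    refine Continuous.aestronglyMeasurable ?_
    refine Continuous.dotProduct (Continuous.star ?_) ?_
    · exact ((hA.comp (by fun_prop)).pow n).matrix_mulVec continuous_const
    · exact ((hA.comp (by fun_prop)).pow n).matrix_mulVec continuous_const
  · exact norm_star_mulVec_dotProduct_le (pow_mem (momentumCoin_mem_unitaryGroup hU _) n)
      (pow_mem (momentumCoin_mem_unitaryGroup hU _) n) _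
  · refine (tendsto_star_rotation_dotProduct (continuous_spinAxis hc0 h1 _).continuousAt
      (conjTranspose_spinAxis _ _ _) (spinAxis_mul_self hc0 h1 hm k)
      (hasDerivAt_arccos_mul_cos hc0 h1 k) hφ t).congr fun n => ?_
    -- Both momenta have the form `k' + θ`, with the same scalar `δ`; the factors `conj δ ^ n` and
    -- `δ ^ n` cancel.
    rw [add_right_comm, hcoin, hcoin, smul_pow, smul_pow,
      rotation_pow (spinAxis_mul_self hc0 h1 hm _), rotation_pow (spinAxis_mul_self hc0 h1 hm _),
      Matrix.smul_mulVec, Matrix.smul_mulVec, star_smul, smul_dotProduct, dotProduct_smul,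
      smul_smul, RCLike.star_def, map_pow, ← mul_pow, hδc, one_pow, one_smul]

/-! ### The limit law -/

theorem beta_eq (U : Matrix (Fin 2) (Fin 2) ℂ) (a b : ℂ) :
    beta U a b = ‖a‖ ^ 2 - ‖b‖ ^ 2
      + 2 * (conj a * b * (conj (U 0 0) * U 0 1 / ‖U 0 0‖)).re / ‖U 0 0‖ := by
  have e : conj (U 0 0) * U 0 1 * conj a * b + U 0 0 * conj (U 0 1) * a * conj b
      = conj a * b * (conj (U 0 0) * U 0 1) + conj (conj a * b * (conj (U 0 0) * U 0 1)) := by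
    simp only [map_mul, Complex.conj_conj]
    ring
  rw [beta, e, Complex.add_conj, Complex.ofReal_re, ← mul_div_assoc (conj a * b),
    Complex.div_ofReal_re, sq ‖U 0 0‖, ← div_div, mul_div_assoc 2]

/-- Separates the part of the expectation that changes sign under `k ↦ π - k` from a multiple of the
velocity. With `c = |l₁|` and `m = conj l₁ * l₂ / |l₁|`, the coefficient of the latter is `-β` by
`beta_eq`. -/
theorem star_dotProduct_spinAxis_mulVec (c : ℝ) {k : ℝ} (hc : c ≠ 0) (hs : energySin c k ≠ 0)
    (m a b : ℂ) :
    star ![a, b] ⬝ᵥ (spinAxis c m k *ᵥ ![a, b])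
      = ((2 * (conj a * b * m).im * (Real.cos k / energySin c k)
        - (‖a‖ ^ 2 - ‖b‖ ^ 2 + 2 * (conj a * b * m).re / c) * velocity c k : ℝ) : ℂ) := by
  set x := (conj a * b * m).re with hx
  set y := (conj a * b * m).im with hy
  have hG : conj a * b * m = x + y * Complex.I := (Complex.re_add_im _).symm
  have hG' : a * conj b * conj m = x - y * Complex.I := by
    have := congrArg conj hG
    simpa [sub_eq_add_neg] using this
  have b1 : Complex.exp (Complex.I * k) = Complex.cos k + Complex.sin k * Complex.I := by
    rw [mul_comm, Complex.exp_mul_I]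
  have b2 : Complex.exp (-(Complex.I * k)) = Complex.cos k - Complex.sin k * Complex.I := by
    rw [show -(Complex.I * (k : ℂ)) = -k * Complex.I by ring, Complex.exp_mul_I,
      Complex.cos_neg, Complex.sin_neg]
    ring
  have hI := Complex.I_mul_I
  have hs' : (energySin c k : ℂ) ≠ 0 := Complex.ofReal_ne_zero.2 hs
  have hc' : (c : ℂ) ≠ 0 := Complex.ofReal_ne_zero.2 hc
  have ha : conj a * a = (‖a‖ : ℂ) ^ 2 := Complex.conj_mul' a
  have hb : conj b * b = (‖b‖ : ℂ) ^ 2 := Complex.conj_mul' b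
  simp only [spinAxis, velocity, Matrix.smul_mulVec, dotProduct_smul]
  simp [dotProduct, Fin.sum_univ_two, b1, b2]
  field_simp
  linear_combination (-(c : ℂ) * Complex.sin k) * ha + (c : ℂ) * Complex.sin k * hb
    - Complex.I * (Complex.cos k - Complex.sin k * Complex.I) * hG
    + Complex.I * (Complex.cos k + Complex.sin k * Complex.I) * hG'
    + (2 * (x : ℂ) * Complex.sin k - 2 * y * Complex.cos k) * hI

/-! ### Symmetries of the velocity and folding of the integral. -/

theorem energySin_neg (c k : ℝ) : energySin c (-k) = energySin c k := by
  simp [energySin]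

theorem energySin_pi_sub (c k : ℝ) : energySin c (Real.pi - k) = energySin c k := by
  simp [energySin]

theorem velocity_neg (c k : ℝ) : velocity c (-k) = -velocity c k := by
  simp [velocity, energySin_neg, neg_div]

theorem velocity_pi_sub (c k : ℝ) : velocity c (Real.pi - k) = velocity c k := by
  simp [velocity, energySin_pi_sub]

theorem velocity_add_two_pi (c k : ℝ) : velocity c (k + 2 * Real.pi) = velocity c k := by
  simp [velocity, energySin]

theorem integral_eq_zero_of_neg {f : ℝ → ℂ} (hf : ∀ x, f (-x) = -f x) (r : ℝ) :
    ∫ x in (-r)..r, f x = 0 := by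
  have h := intervalIntegral.integral_comp_neg (a := -r) (b := r) f
  simp only [hf, intervalIntegral.integral_neg, neg_neg] at h
  exact self_eq_neg.1 h.symm

/-- The integral of a periodic function over a full period, folded by the reflection about
`π / 2`. -/
theorem integral_eq_integral_add_reflection {f : ℝ → ℂ} (hf : Continuous f)
    (hp : Function.Periodic f (2 * Real.pi)) :
    ∫ k in (-Real.pi)..Real.pi, f k
      = ∫ k in (-(Real.pi / 2))..(Real.pi / 2), (f k + f (Real.pi - k)) := by
  have h1 := hp.intervalIntegral_add_eq (-Real.pi) (-(Real.pi / 2))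
  rw [show -Real.pi + 2 * Real.pi = Real.pi by ring] at h1
  have hi : ∀ x y, IntervalIntegrable f volume x y := fun x y => hf.intervalIntegrable x y
  rw [h1, ← intervalIntegral.integral_add_adjacent_intervals (hi _ (Real.pi / 2)) (hi _ _),
    intervalIntegral.integral_add (hi _ _)
      (Continuous.intervalIntegrable (by fun_prop) _ _),
    intervalIntegral.integral_comp_sub_left]
  congr 2 <;> ring

theorem integral_charFun_symmetrize {c : ℝ} (hc0 : 0 < c) (hc1 : c < 1) (β γ t : ℝ) :
    (2 * Real.pi : ℂ)⁻¹ * ∫ k in (-Real.pi)..Real.pi, (Real.cos (t * velocity c k)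
        + Complex.I * ((γ * (Real.cos k / energySin c k) - β * velocity c k : ℝ) : ℂ)
          * Real.sin (t * velocity c k))
      = (Real.pi : ℂ)⁻¹ * ∫ k in (-(Real.pi / 2))..(Real.pi / 2),
        ((1 - β * velocity c k : ℝ) : ℂ) * Complex.exp (t * velocity c k * Complex.I) := by
  have hv := continuous_velocity hc0 hc1
  have hq : Continuous fun k => Real.cos k / energySin c k :=
    Real.continuous_cos.div (continuous_energySin c) fun k => (energySin_pos hc0 hc1 k).ne'
  rw [integral_eq_integral_add_reflection]
  -- The folded integrand is twice the target minus twice a function odd in `k`, which integrates to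
  -- zero over the symmetric interval.
  · have e : ∀ k : ℝ, ((Real.cos (t * velocity c k)
        + Complex.I * ((γ * (Real.cos k / energySin c k) - β * velocity c k : ℝ) : ℂ)
          * Real.sin (t * velocity c k))
        + (Real.cos (t * velocity c (Real.pi - k))
        + Complex.I * ((γ * (Real.cos (Real.pi - k) / energySin c (Real.pi - k))
          - β * velocity c (Real.pi - k) : ℝ) : ℂ) * Real.sin (t * velocity c (Real.pi - k))))
        = 2 * (((1 - β * velocity c k : ℝ) : ℂ) * Complex.exp (t * velocity c k * Complex.I)
          - (Complex.I * Real.sin (t * velocity c k)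
            - (β * velocity c k : ℝ) * Real.cos (t * velocity c k))) := by
      intro k
      rw [velocity_pi_sub, energySin_pi_sub, Real.cos_pi_sub, Complex.exp_mul_I]
      push_cast
      ring
    simp_rw [e]
    rw [intervalIntegral.integral_const_mul, intervalIntegral.integral_sub,
      integral_eq_zero_of_neg (f := fun k => Complex.I * Real.sin (t * velocity c k)
            - (β * velocity c k : ℝ) * Real.cos (t * velocity c k)), sub_zero, ← mul_assoc]
    · congr 1
      have : (Real.pi : ℂ) ≠ 0 := by simp [Real.pi_ne_zero]
      field_simp
    · intro k
      simp [velocity_neg]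
      ring
    · exact Continuous.intervalIntegrable (by fun_prop) _ _
    · exact Continuous.intervalIntegrable (by fun_prop) _ _
  · fun_prop
  · intro k
    simp only [velocity_add_two_pi, Real.cos_add_two_pi, energySin]

/-! ### The velocity as a change of variables. -/

theorem hasDerivAt_velocity {c : ℝ} (hc0 : 0 < c) (hc1 : c < 1) (k : ℝ) :
    HasDerivAt (velocity c) (c * Real.cos k * (1 - c ^ 2) / energySin c k ^ 3) k := by
  have hs := (energySin_pos hc0 hc1 k).ne'
  have h1 : HasDerivAt (fun k => 1 - c ^ 2 * Real.cos k ^ 2)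
      (2 * c ^ 2 * Real.cos k * Real.sin k) k := by
    refine ((((Real.hasDerivAt_cos k).pow 2).const_mul (c ^ 2)).const_sub 1).congr_deriv ?_
    simp
    ring
  have h2 : HasDerivAt (energySin c) _ k := h1.sqrt (one_sub_sq_mul_cos_sq_pos hc0 hc1 k).ne'
  refine (((Real.hasDerivAt_sin k).const_mul c).div h2 hs).congr_deriv ?_
  change (c * Real.cos k * energySin c k
    - c * Real.sin k * (2 * c ^ 2 * Real.cos k * Real.sin k / (2 * energySin c k)))
      / energySin c k ^ 2 = _
  field_simp
  rw [energySin_sq hc0 hc1]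
  linear_combination (-c ^ 2 * Real.cos k) * Real.sin_sq_add_cos_sq k

theorem strictMonoOn_velocity {c : ℝ} (hc0 : 0 < c) (hc1 : c < 1) :
    StrictMonoOn (velocity c) (Set.Icc (-(Real.pi / 2)) (Real.pi / 2)) := by
  refine strictMonoOn_of_deriv_pos (convex_Icc _ _) (continuous_velocity hc0 hc1).continuousOn
    fun k hk => ?_
  rw [interior_Icc] at hk
  rw [(hasDerivAt_velocity hc0 hc1 k).deriv]
  have := Real.cos_pos_of_mem_Ioo hk
  have := energySin_pos hc0 hc1 k
  have : 0 < 1 - c ^ 2 := by nlinarith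
  positivity

theorem velocity_pi_div_two (c : ℝ) : velocity c (Real.pi / 2) = c := by
  simp [velocity, energySin]

theorem image_velocity {c : ℝ} (hc0 : 0 < c) (hc1 : c < 1) :
    velocity c '' Set.Ioo (-(Real.pi / 2)) (Real.pi / 2) = Set.Ioo (-c) c := by
  have hle : -(Real.pi / 2) ≤ Real.pi / 2 := by linarith [Real.pi_pos]
  have e : velocity c (-(Real.pi / 2)) = -c := by rw [velocity_neg, velocity_pi_div_two]
  refine Set.Subset.antisymm ?_ ?_
  · rintro _ ⟨k, hk, rfl⟩
    have hm := strictMonoOn_velocity hc0 hc1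
    have l := hm (Set.left_mem_Icc.2 hle) (Set.Ioo_subset_Icc_self hk) hk.1
    have r := hm (Set.Ioo_subset_Icc_self hk) (Set.right_mem_Icc.2 hle) hk.2
    rw [e] at l
    rw [velocity_pi_div_two] at r
    exact ⟨l, r⟩
  · have := intermediate_value_Ioo hle (continuous_velocity hc0 hc1).continuousOn
    rwa [e, velocity_pi_div_two] at this

/-- The Konno density on its support, times the derivative of the velocity, is constant. -/
theorem deriv_velocity_mul_density {c : ℝ} (hc0 : 0 < c) (hc1 : c < 1) {k : ℝ}
    (hk : k ∈ Set.Ioo (-(Real.pi / 2)) (Real.pi / 2)) :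
    |c * Real.cos k * (1 - c ^ 2) / energySin c k ^ 3|
      * (√(1 - c ^ 2) / (Real.pi * (1 - velocity c k ^ 2) * √(c ^ 2 - velocity c k ^ 2)))
      = Real.pi⁻¹ := by
  have hcos := Real.cos_pos_of_mem_Ioo hk
  have hs := energySin_pos hc0 hc1 k
  have hs2 := energySin_sq hc0 hc1 k
  have hd : 0 < 1 - c ^ 2 := by nlinarith
  have hsc := Real.sin_sq_add_cos_sq k
  have e1 : 1 - velocity c k ^ 2 = (1 - c ^ 2) / energySin c k ^ 2 := by
    rw [velocity, div_pow]
    field_simp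
    rw [hs2]
    linear_combination (-c ^ 2) * hsc
  have e2 : c ^ 2 - velocity c k ^ 2
      = (c * Real.cos k / energySin c k) ^ 2 * (1 - c ^ 2) := by
    rw [velocity, div_pow, div_pow]
    field_simp
    rw [hs2]
    linear_combination (-1 : ℝ) * hsc
  have hr := Real.sqrt_pos.2 hd
  have hpi := Real.pi_pos
  rw [e1, e2, Real.sqrt_mul (sq_nonneg _), Real.sqrt_sq (by positivity), abs_of_pos (by positivity)]
  field_simp

/-! ### Nonnegativity of the density. -/

/-- Cauchy–Schwarz for `(A - B, 2x / √(1 - c²))` and the unit vector `(c, √(1 - c²))`: the first has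
squared norm at most `(A - B)² + 4AB = 1`. The identity in `key` is Lagrange's, cleared of
denominators. -/
theorem abs_drift_mul_le_one {c A B x : ℝ} (hc0 : 0 < c) (hc1 : c < 1) (hAB : A + B = 1)
    (hx : x ^ 2 ≤ A * B * (1 - c ^ 2)) : |(A - B + 2 * x / c) * c| ≤ 1 := by
  have e : (A - B + 2 * x / c) * c = (A - B) * c + 2 * x := by field_simp
  rw [e, ← sq_le_one_iff_abs_le_one]
  have hd : 0 < 1 - c ^ 2 := by nlinarith
  have hD : (A - B) ^ 2 = 1 - 4 * (A * B) := by linear_combination (A + B + 1) * hAB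
  have key : 0 ≤ (1 - c ^ 2) * (1 - ((A - B) * c + 2 * x) ^ 2) := by
    have hsq := sq_nonneg ((A - B) * (1 - c ^ 2) - 2 * c * x)
    have : (1 - c ^ 2) * (1 - ((A - B) * c + 2 * x) ^ 2)
        = ((A - B) * (1 - c ^ 2) - 2 * c * x) ^ 2 + 4 * (A * B * (1 - c ^ 2) - x ^ 2) := by
      linear_combination (c ^ 2 - 1) * hD
    linarith
  linarith [nonneg_of_mul_nonneg_right key hd]

theorem norm_lt_one_of_mem_unitaryGroup {U : Matrix (Fin 2) (Fin 2) ℂ}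
    (hU : U ∈ Matrix.unitaryGroup (Fin 2) ℂ) (h1 : U 0 1 ≠ 0) : ‖U 0 0‖ < 1 := by
  have h := norm_sq_add_norm_sq_of_mem_unitaryGroup hU
  have := norm_pos_iff.2 h1
  nlinarith [norm_nonneg (U 0 0)]

theorem one_sub_beta_mul_nonneg {U : Matrix (Fin 2) (Fin 2) ℂ}
    (hU : U ∈ Matrix.unitaryGroup (Fin 2) ℂ) (h0 : U 0 0 ≠ 0) (h1 : ‖U 0 0‖ < 1) {a b : ℂ}
    (hab : ‖a‖ ^ 2 + ‖b‖ ^ 2 = 1) {y : ℝ} (hy : |y| ≤ ‖U 0 0‖) : 0 ≤ 1 - beta U a b * y := by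
  have hc0 : 0 < ‖U 0 0‖ := norm_pos_iff.2 h0
  have hx : (conj a * b * (conj (U 0 0) * U 0 1 / ‖U 0 0‖)).re ^ 2
      ≤ ‖a‖ ^ 2 * ‖b‖ ^ 2 * (1 - ‖U 0 0‖ ^ 2) := by
    have hn := sq_le_sq' (abs_le.1 (Complex.abs_re_le_norm
      (conj a * b * (conj (U 0 0) * U 0 1 / ‖U 0 0‖)))).1 (Complex.re_le_norm _)
    rw [norm_mul, norm_mul, norm_div, norm_mul, Complex.norm_conj, Complex.norm_conj,
      Complex.norm_real, norm_norm, mul_div_cancel_left₀ _ hc0.ne'] at hn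
    refine hn.trans (le_of_eq ?_)
    linear_combination (‖a‖ ^ 2 * ‖b‖ ^ 2) * norm_sq_add_norm_sq_of_mem_unitaryGroup hU
  have hb := abs_drift_mul_le_one hc0 h1 hab hx
  rw [← beta_eq, abs_mul, abs_of_pos hc0] at hb
  have : |beta U a b * y| ≤ 1 := by
    rw [abs_mul]
    exact (mul_le_mul_of_nonneg_left hy (abs_nonneg _)).trans hb
  linarith [(abs_le.1 this).2]

theorem limitDensity_nonneg {U : Matrix (Fin 2) (Fin 2) ℂ}
    (hU : U ∈ Matrix.unitaryGroup (Fin 2) ℂ) (h0 : U 0 0 ≠ 0) (h1 : ‖U 0 0‖ < 1) {a b : ℂ}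
    (hab : ‖a‖ ^ 2 + ‖b‖ ^ 2 = 1) (y : ℝ) : 0 ≤ limitDensity U a b y := by
  refine Set.indicator_nonneg (fun y hy => mul_nonneg ?_ ?_) y
  · have : 0 ≤ 1 - y ^ 2 := by nlinarith [hy.1, hy.2]
    have := Real.pi_pos
    positivity
  · exact one_sub_beta_mul_nonneg hU h0 h1 hab (abs_le.2 ⟨hy.1.le, hy.2.le⟩)

theorem measurable_limitDensity (U : Matrix (Fin 2) (Fin 2) ℂ) (a b : ℂ) :
    Measurable (limitDensity U a b) :=
  Measurable.indicator (by fun_prop) measurableSet_Ioo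

theorem deriv_velocity_mul_limitDensity {U : Matrix (Fin 2) (Fin 2) ℂ} (h0 : U 0 0 ≠ 0)
    (h1 : ‖U 0 0‖ < 1) (a b : ℂ) {k : ℝ} (hk : k ∈ Set.Ioo (-(Real.pi / 2)) (Real.pi / 2)) :
    |‖U 0 0‖ * Real.cos k * (1 - ‖U 0 0‖ ^ 2) / energySin ‖U 0 0‖ k ^ 3|
      * limitDensity U a b (velocity ‖U 0 0‖ k)
      = Real.pi⁻¹ * (1 - beta U a b * velocity ‖U 0 0‖ k) := by
  have hc0 : 0 < ‖U 0 0‖ := norm_pos_iff.2 h0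
  have hmem : velocity ‖U 0 0‖ k ∈ Set.Ioo (-‖U 0 0‖) ‖U 0 0‖ := by
    rw [← image_velocity hc0 h1]
    exact Set.mem_image_of_mem _ hk
  rw [limitDensity, Set.indicator_of_mem hmem, ← mul_assoc, deriv_velocity_mul_density hc0 h1 hk]

theorem injOn_velocity {c : ℝ} (hc0 : 0 < c) (hc1 : c < 1) :
    Set.InjOn (velocity c) (Set.Ioo (-(Real.pi / 2)) (Real.pi / 2)) :=
  ((strictMonoOn_velocity hc0 hc1).mono Set.Ioo_subset_Icc_self).injOn

/-! ### Total mass and characteristic function of the limit law. -/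

theorem lintegral_limitDensity {U : Matrix (Fin 2) (Fin 2) ℂ}
    (hU : U ∈ Matrix.unitaryGroup (Fin 2) ℂ) (h0 : U 0 0 ≠ 0) (h1 : ‖U 0 0‖ < 1) {a b : ℂ}
    (hab : ‖a‖ ^ 2 + ‖b‖ ^ 2 = 1) :
    ∫⁻ y, ENNReal.ofReal (limitDensity U a b y) = 1 := by
  have hc0 : 0 < ‖U 0 0‖ := norm_pos_iff.2 h0
  have hv := continuous_velocity hc0 h1
  have hle : -(Real.pi / 2) ≤ Real.pi / 2 := by linarith [Real.pi_pos]
  have e1 : ∫⁻ y, ENNReal.ofReal (limitDensity U a b y)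
      = ∫⁻ y in Set.Ioo (-‖U 0 0‖) ‖U 0 0‖, ENNReal.ofReal (limitDensity U a b y) := by
    rw [← lintegral_indicator measurableSet_Ioo]
    refine lintegral_congr fun y => ?_
    by_cases hy : y ∈ Set.Ioo (-‖U 0 0‖) ‖U 0 0‖
    · rw [Set.indicator_of_mem hy]
    · rw [Set.indicator_of_notMem hy, limitDensity, Set.indicator_of_notMem hy, ENNReal.ofReal_zero]
  rw [e1, ← image_velocity hc0 h1, lintegral_image_eq_lintegral_abs_deriv_mul measurableSet_Ioo
    (fun k _ => (hasDerivAt_velocity hc0 h1 k).hasDerivWithinAt) (injOn_velocity hc0 h1),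
    setLIntegral_congr_fun (g := fun k =>
      ENNReal.ofReal (Real.pi⁻¹ * (1 - beta U a b * velocity ‖U 0 0‖ k))) measurableSet_Ioo
      (fun k hk => by
        rw [← ENNReal.ofReal_mul (abs_nonneg _), deriv_velocity_mul_limitDensity h0 h1 a b hk]),
    ← ofReal_integral_eq_lintegral_ofReal, ← integral_Ioc_eq_integral_Ioo,
    ← intervalIntegral.integral_of_le hle, intervalIntegral.integral_const_mul,
    intervalIntegral.integral_sub, intervalIntegral.integral_const_mul]
  -- The velocity is odd, so the drift `β` does not affect the total mass.
  · have hz : ∫ k in (-(Real.pi / 2))..(Real.pi / 2), velocity ‖U 0 0‖ k = 0 := by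
      have := integral_eq_zero_of_neg (f := fun k => (velocity ‖U 0 0‖ k : ℂ))
        (fun k => by rw [velocity_neg, Complex.ofReal_neg]) (Real.pi / 2)
      rw [intervalIntegral.integral_ofReal] at this
      exact_mod_cast this
    rw [hz]
    simp [Real.pi_ne_zero]
  · exact Continuous.intervalIntegrable (by fun_prop) _ _
  · exact Continuous.intervalIntegrable (by fun_prop) _ _
  · exact ((by fun_prop : Continuous fun k => Real.pi⁻¹ * (1 - beta U a b * velocity ‖U 0 0‖ k)
      ).integrableOn_Icc).mono_set Set.Ioo_subset_Icc_self
  · refine (ae_restrict_iff' measurableSet_Ioo).2 (ae_of_all _ fun k hk => ?_)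
    have hmem : velocity ‖U 0 0‖ k ∈ Set.Ioo (-‖U 0 0‖) ‖U 0 0‖ := by
      rw [← image_velocity hc0 h1]
      exact Set.mem_image_of_mem _ hk
    exact mul_nonneg (inv_nonneg.2 Real.pi_pos.le)
      (one_sub_beta_mul_nonneg hU h0 h1 hab (abs_le.2 ⟨hmem.1.le, hmem.2.le⟩))

theorem charFun_withDensity_limitDensity {U : Matrix (Fin 2) (Fin 2) ℂ}
    (hU : U ∈ Matrix.unitaryGroup (Fin 2) ℂ) (h0 : U 0 0 ≠ 0) (h1 : ‖U 0 0‖ < 1) {a b : ℂ}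
    (hab : ‖a‖ ^ 2 + ‖b‖ ^ 2 = 1) (t : ℝ) :
    charFun (volume.withDensity fun y => ENNReal.ofReal (limitDensity U a b y)) t
      = (Real.pi : ℂ)⁻¹ * ∫ k in (-(Real.pi / 2))..(Real.pi / 2),
        ((1 - beta U a b * velocity ‖U 0 0‖ k : ℝ) : ℂ)
          * Complex.exp (t * velocity ‖U 0 0‖ k * Complex.I) := by
  have hc0 : 0 < ‖U 0 0‖ := norm_pos_iff.2 h0
  have hle : -(Real.pi / 2) ≤ Real.pi / 2 := by linarith [Real.pi_pos]
  rw [charFun_apply_real, integral_withDensity_eq_integral_toReal_smul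
    (measurable_limitDensity U a b).ennreal_ofReal (ae_of_all _ fun _ => ENNReal.ofReal_lt_top)]
  simp_rw [ENNReal.toReal_ofReal (limitDensity_nonneg hU h0 h1 hab _)]
  rw [← setIntegral_eq_integral_of_forall_compl_eq_zero (s := Set.Ioo (-‖U 0 0‖) ‖U 0 0‖)
    (fun y hy => by rw [limitDensity, Set.indicator_of_notMem hy, zero_smul]),
    ← image_velocity hc0 h1, integral_image_eq_integral_abs_deriv_smul measurableSet_Ioo
    (fun k _ => (hasDerivAt_velocity hc0 h1 k).hasDerivWithinAt) (injOn_velocity hc0 h1),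
    ← intervalIntegral.integral_const_mul, intervalIntegral.integral_of_le hle,
    integral_Ioc_eq_integral_Ioo]
  refine setIntegral_congr_fun measurableSet_Ioo fun k hk => ?_
  rw [smul_smul, deriv_velocity_mul_limitDensity h0 h1 a b hk, Complex.real_smul,
    Complex.ofReal_mul, Complex.ofReal_inv, mul_assoc]

end QuantumWalk

theorem proposition2p3
    (U : Matrix (Fin 2) (Fin 2) ℂ) (hU : U ∈ Matrix.unitaryGroup (Fin 2) ℂ)
    (hne : U 0 0 * U 0 1 * U 1 0 * U 1 1 ≠ 0)
    (a b : ℂ) (hab : ‖a‖ ^ 2 + ‖b‖ ^ 2 = 1) :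
    (∀ y : ℝ, 0 ≤ QuantumWalk.limitDensity U a b y) ∧
    ∃ μ : ProbabilityMeasure ℝ,
      Tendsto (QuantumWalk.scaledLaw hU (QuantumWalk.isUnitState_originState hab)) atTop (𝓝 μ) ∧
      (μ : Measure ℝ) =
        volume.withDensity fun y => ENNReal.ofReal (QuantumWalk.limitDensity U a b y) := by
  have h01 : U 0 0 ≠ 0 ∧ U 0 1 ≠ 0 := by
    simp only [ne_eq, mul_eq_zero, not_or] at hne
    exact hne.1.1
  have h1 := QuantumWalk.norm_lt_one_of_mem_unitaryGroup hU h01.2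
  have hc0 : 0 < ‖U 0 0‖ := norm_pos_iff.2 h01.1
  have hprob : IsProbabilityMeasure
      (volume.withDensity fun y => ENNReal.ofReal (QuantumWalk.limitDensity U a b y)) := by
    constructor
    rw [withDensity_apply _ MeasurableSet.univ, Measure.restrict_univ]
    exact QuantumWalk.lintegral_limitDensity hU h01.1 h1 hab
  refine ⟨QuantumWalk.limitDensity_nonneg hU h01.1 h1 hab, ⟨_, hprob⟩, ?_, rfl⟩
  -- Lévy's continuity theorem: it remains to identify the limit of the characteristic functions
  -- with that of the density.
  refine ProbabilityMeasure.tendsto_iff_tendsto_charFun.2 fun t => ?_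
  have h := QuantumWalk.tendsto_charFun_scaledLaw hU h01.1 h1 hab t
  simp_rw [fun k => QuantumWalk.star_dotProduct_spinAxis_mulVec ‖U 0 0‖ hc0.ne'
    (QuantumWalk.energySin_pos hc0 h1 k).ne' (conj (U 0 0) * U 0 1 / ‖U 0 0‖) a b,
    ← QuantumWalk.beta_eq, QuantumWalk.integral_charFun_symmetrize hc0 h1] at h
  rw [← QuantumWalk.charFun_withDensity_limitDensity hU h01.1 h1 hab] at h
  exact h
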